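/- All functions take values in a fixed scalar field, $\mathbb{R}$ or $\mathbb{C}$. For a topological space $X$ let $C_b(X)$ be the algebra of bounded continuous scalar functions on $X$ with the supremum norm, $C_0(X)$ the subalgebra of those $f\in C_b(X)$ for which $\{x : |f(x)|\ge\varepsilon\}$ is compact for every $\varepsilon>0$, and $C_c(X)$ the subalgebra of those $f$ whose support $\operatorname{supp} f=\overline{\{x: f(x)\neq 0\}}$ is compact. For an infinite cardinal $\kappa$, a space is $\kappa$-Lindelöf if each of its open covers has a subcover of cardinality at most $\kappa$, and it is Lindelöf if it is $\aleph_0$-Lindelöf. The Lindelöf number is $$\ell(X)=\min\{\mathfrak n : \text{every open cover of } X \text{ has a subcover of cardinality}\le\mathfrak n\}+\aleph_0 .$$ **Theorem.** Let $X$ be a space that is not Lindelöf, and suppose that $X$ is either locally compact, Hausdorff and paracompact, or metrizable and locally Lindelöf (each point has a Lindelöf neighbourhood). Then there are an ordinal $\lambda$ with $\aleph_\lambda=\ell(X)$ and a chain $$C_0(X)\subsetneq H_0\subsetneq H_1\subsetneq\cdots\subsetneq H_\lambda=C_b(X)$$ of subalgebras of $C_b(X)$ (that is, $C_0(X)\subsetneq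 H_0$, $H_\lambda=C_b(X)$, and $H_\mu\subsetneq H_\kappa$ whenever $\mu<\kappa\le\lambda$) such that, for every ordinal $\mu\le\lambda$: 1. $H_\mu=\{f\in C_b(X) : \operatorname{supp} f \text{ is } \aleph_\mu\text{-Lindelöf}\}$; 2. $H_\mu$ is closed in $C_b(X)$ (hence a Banach subalgebra) and is an ideal of $C_b(X)$; 3. there is a locally compact Hausdorff space $Y_\mu$ such that $C_0(Y_\mu)=C_c(Y_\mu)$ and $H_\mu$ is isometrically isomorphic, as a normed algebra, to $C_0(Y_\mu)$. -/

import Mathlib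

open scoped BoundedContinuousFunction Topology Cardinal

universe u v

section Lindelof

variable {X : Type u} [TopologicalSpace X]

/-- A subset `s` of a space is `κ`-Lindelöf (in its subspace topology): every cover of `s` by open
sets of the ambient space has a subcover of cardinality at most `κ`. -/
def IsCardLindelof (κ : Cardinal.{u}) (s : Set X) : Prop :=
  ∀ 𝒰 : Set (Set X), (∀ U ∈ 𝒰, IsOpen U) → s ⊆ ⋃₀ 𝒰 →
    ∃ 𝒱 : Set (Set X), 𝒱 ⊆ 𝒰 ∧ Cardinal.mk 𝒱 ≤ κ ∧ s ⊆ ⋃₀ 𝒱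

variable (X)

/-- The Lindelöf number: the least `κ` such that every open cover of `X` has a subcover of
cardinality at most `κ`, plus `ℵ₀`. -/
noncomputable def lindelofNumber : Cardinal.{u} :=
  sInf {κ : Cardinal.{u} | IsCardLindelof κ (Set.univ : Set X)} + ℵ₀

/-- The infimum defining the Lindelöf number is over a nonempty set, hence a minimum. -/
theorem exists_isCardLindelof_univ :
    {κ : Cardinal.{u} | IsCardLindelof κ (Set.univ : Set X)}.Nonempty :=
  ⟨Cardinal.mk (Set X), fun 𝒰 _ h => ⟨𝒰, subset_rfl, Cardinal.mk_set_le 𝒰, h⟩⟩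

/-- Every point has a neighbourhood that is a Lindelöf subspace. -/
def IsLocallyLindelof : Prop := ∀ x : X, ∃ N ∈ 𝓝 x, IsLindelof N

end Lindelof

section Subalgebras

variable (X : Type u) [TopologicalSpace X] (𝕜 : Type v) [RCLike 𝕜]

/-- `C₀(X)`, as a subalgebra of `C_b(X)`: the functions `f` such that `{x | ε ≤ ‖f x‖}` is compact
for every `ε > 0`. -/
def boundedVanishing : NonUnitalSubalgebra 𝕜 (X →ᵇ 𝕜) where
  carrier := {f | ∀ ε : ℝ, 0 < ε → IsCompact {x | ε ≤ ‖f x‖}}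
  zero_mem' := by
    intro ε hε
    have : {x : X | ε ≤ ‖(0 : X →ᵇ 𝕜) x‖} = ∅ := by
      ext x
      simp [hε]
    rw [this]
    exact isCompact_empty
  add_mem' := by
    intro f g hf hg ε hε
    refine ((hf (ε / 2) (half_pos hε)).union (hg (ε / 2) (half_pos hε))).of_isClosed_subset
      (isClosed_le continuous_const (f + g).continuous.norm) ?_
    intro x hx
    by_contra h
    simp only [Set.mem_union, Set.mem_ofPred_eq, not_or, not_le] at h hx
    have := norm_add_le (f x) (g x)
    rw [BoundedContinuousFunction.add_apply] at hx
    linarith [h.1, h.2]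
  mul_mem' := by
    intro f g hf hg ε hε
    have hg0 : (0 : ℝ) < ‖g‖ + 1 := by positivity
    refine (hf (ε / (‖g‖ + 1)) (by positivity)).of_isClosed_subset
      (isClosed_le continuous_const (f * g).continuous.norm) ?_
    intro x hx
    simp only [Set.mem_ofPred_eq, BoundedContinuousFunction.mul_apply, norm_mul] at hx ⊢
    rw [div_le_iff₀ hg0]
    refine hx.trans (mul_le_mul_of_nonneg_left ?_ (norm_nonneg _))
    linarith [g.norm_coe_le_norm x]
  smul_mem' := by
    intro c f hf ε hε
    have hc0 : (0 : ℝ) < ‖c‖ + 1 := by positivity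
    refine (hf (ε / (‖c‖ + 1)) (by positivity)).of_isClosed_subset
      (isClosed_le continuous_const (c • f).continuous.norm) ?_
    intro x hx
    simp only [Set.mem_ofPred_eq, BoundedContinuousFunction.coe_smul, norm_smul] at hx ⊢
    rw [div_le_iff₀ hc0]
    nlinarith [norm_nonneg (f x)]

/-- `C_c(X)`, as a subalgebra of `C_b(X)`: the functions with compact support. -/
def boundedCompactSupport : NonUnitalSubalgebra 𝕜 (X →ᵇ 𝕜) where
  carrier := {f | IsCompact (tsupport f)}
  zero_mem' := by
    have h : tsupport (⇑(0 : X →ᵇ 𝕜)) = ∅ := tsupport_eq_empty_iff.mpr rfl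
    simp only [Set.mem_ofPred_eq]
    rw [h]
    exact isCompact_empty
  add_mem' := by
    intro f g hf hg
    exact HasCompactSupport.add (f := ⇑f) (f' := ⇑g) hf hg
  mul_mem' := by
    intro f g hf _
    exact HasCompactSupport.mul_right (f := ⇑f) (f' := ⇑g) hf
  smul_mem' := by
    intro c f hf
    exact HasCompactSupport.smul_left (f := fun _ : X => c) (f' := ⇑f) hf

end Subalgebras

open Set

/-! ### Splitting a paracompact locally Lindelöf space into clopen Lindelöf pieces. -/

section Decomposition

variable {X : Type u} [TopologicalSpace X]

/-! Both hypotheses on `X` yield a partition into open Lindelöf pieces, the fibres of a map `q : X →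
I`. This turns topology into counting. For infinite `κ`, a closed set is `κ`-Lindelöf exactly when
it meets at most `κ` fibres. Since `X` is not Lindelöf, `I` is uncountable, and `#I` is the Lindelöf
number. So `H μ` consists of the functions living on at most `ℵ_ μ` fibres. It is norm closed
because `ℵ₀ * κ = κ`, and the chain is strict because unions of fibres are clopen and have
continuous indicators. For `Y`, take in the Stone–Čech compactification the union of the clopen
compact closures of unions of at most `κ` fibres. It is open, hence locally compact. Countably many
of these closures lie in a single one, so every `C₀` function on `Y` has compact support.
Restriction to the dense image of `X` is the isometry onto `H μ`. -/

theorem IsLindelof.countable_inter_nonempty {ι : Type*} {V : ι → Set X} (hV : LocallyFinite V)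
    {K : Set X} (hK : IsLindelof K) : {i | (V i ∩ K).Nonempty}.Countable := by
  choose N hN hfin using hV
  obtain ⟨t, htc, -, ht⟩ := hK.elim_nhds_subcover N (fun x _ => hN x)
  refine (htc.biUnion fun x _ => (hfin x).countable).mono ?_
  rintro i ⟨x, hxV, hxK⟩
  obtain ⟨y, hy, hxy⟩ := mem_iUnion₂.1 (ht hxK)
  exact mem_iUnion₂.2 ⟨y, hy, x, hxV, hxy⟩

/-- Iterate the successor operation `ω` times: each stage is countable, and so is their union. -/
theorem Set.Countable.exists_saturated {ι : Type*} (r : ι → ι → Prop)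
    (hr : ∀ a, {b | r a b}.Countable) {s : Set ι} (hs : s.Countable) :
    ∃ t : Set ι, t.Countable ∧ s ⊆ t ∧ ∀ a ∈ t, ∀ b, r a b → b ∈ t := by
  let S : ℕ → Set ι := fun n => Nat.rec s (fun _ t => ⋃ a ∈ t, {b | r a b}) n
  have hS : ∀ n, (S n).Countable := by
    intro n
    induction n with
    | zero => exact hs
    | succ n ih => exact ih.biUnion fun a _ => hr a
  refine ⟨⋃ n, S n, countable_iUnion hS, subset_iUnion S 0, ?_⟩
  intro a ha b hab
  obtain ⟨n, hn⟩ := mem_iUnion.1 ha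
  exact mem_iUnion.2 ⟨n + 1, mem_iUnion₂.2 ⟨a, hn, hab⟩⟩

/-- A paracompact locally Lindelöf space is the disjoint union of open Lindelöf subspaces. -/
theorem IsLocallyLindelof.exists_lindelof_fibres [ParacompactSpace X] (hX : IsLocallyLindelof X) :
    ∃ (I : Type u) (q : X → I), Function.Surjective q ∧ (∀ i, IsOpen (q ⁻¹' {i})) ∧
      ∀ i, IsLindelof (q ⁻¹' {i}) := by
  choose N hN hNL using hX
  obtain ⟨V, hVo, hVc, hVf, hVN⟩ := precise_refinement (fun x => interior (N x))
    (fun _ => isOpen_interior)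
    (eq_univ_of_forall fun x => mem_iUnion.2 ⟨x, mem_interior_iff_mem_nhds.2 (hN x)⟩)
  have hVN' : ∀ a, V a ⊆ N a := fun a => (hVN a).trans interior_subset
  have hmem : ∀ x, ∃ a, x ∈ V a := fun x => mem_iUnion.1 (hVc ▸ mem_univ x)
  -- Classes are the sets of points linked by finite chains of overlapping `V a`. Each `V a` lies in
  -- one class, so any union of classes is open.
  let s : Setoid X := Relation.EqvGen.setoid fun x y => ∃ a, x ∈ V a ∧ y ∈ V a
  let q : X → Quotient s := Quotient.mk s
  have hq : ∀ a x y, x ∈ V a → y ∈ V a → q x = q y := fun a x y hx hy =>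
    Quotient.sound (Relation.EqvGen.rel _ _ ⟨a, hx, hy⟩)
  have hopen : ∀ T : Set (Quotient s), IsOpen (q ⁻¹' T) := by
    intro T
    refine isOpen_iff_mem_nhds.2 fun x hx => ?_
    obtain ⟨a, ha⟩ := hmem x
    refine Filter.mem_of_superset ((hVo a).mem_nhds ha) fun y hy => ?_
    rw [mem_preimage, hq a y x hy ha]
    exact hx
  refine ⟨Quotient s, q, Quotient.mk_surjective, fun i => hopen _, fun i => ?_⟩
  obtain ⟨x, rfl⟩ := Quotient.mk_surjective i
  -- Start from the finitely many `V a` containing `x`. Each Lindelöf `N a` meets only countably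
  -- many `V b`, so all chains from `x` stay within countably many indices.
  obtain ⟨t, htc, hxt, ht⟩ := Set.Countable.exists_saturated
    (fun a b => (V b ∩ N a).Nonempty)
    (fun a => (hNL a).countable_inter_nonempty hVf)
    (hVf.point_finite x).countable
  have key : ∀ y z, Relation.EqvGen (fun x y => ∃ a, x ∈ V a ∧ y ∈ V a) y z →
      (y ∈ ⋃ a ∈ t, V a ↔ z ∈ ⋃ a ∈ t, V a) := by
    have step : ∀ a y z, y ∈ V a → z ∈ V a → y ∈ ⋃ a ∈ t, V a → z ∈ ⋃ a ∈ t, V a := by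
      intro a y z hy hz h
      obtain ⟨b, hb, hyb⟩ := mem_iUnion₂.1 h
      exact mem_iUnion₂.2 ⟨a, ht b hb a ⟨y, hy, hVN' b hyb⟩, hz⟩
    intro y z h
    induction h with
    | rel y z h =>
      obtain ⟨a, hy, hz⟩ := h
      exact ⟨step a y z hy hz, step a z y hz hy⟩
    | refl => rfl
    | symm _ _ _ ih => exact ih.symm
    | trans _ _ _ _ _ ih₁ ih₂ => exact ih₁.trans ih₂
  -- The `V a` need not be Lindelöf, but the class is closed and lies in the countable union of the
  -- `N a`, `a ∈ t`.
  refine IsLindelof.of_isClosed_subset (htc.isLindelof_biUnion fun a _ => hNL a) ?_ ?_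
  · rw [← isOpen_compl_iff, ← preimage_compl]
    exact hopen _
  · intro y hy
    have hyx : Relation.EqvGen (fun x y => ∃ a, x ∈ V a ∧ y ∈ V a) y x := Quotient.exact hy
    obtain ⟨a, ha⟩ := hmem x
    obtain ⟨b, hb, hyb⟩ := mem_iUnion₂.1
      ((key y x hyx).2 (mem_iUnion₂.2 ⟨a, hxt ha, ha⟩))
    exact mem_iUnion₂.2 ⟨b, hb, hVN' b hyb⟩

end Decomposition

/-! ### Lindelöf degree as a count of fibres. -/

section Fibres

variable {X : Type u} [TopologicalSpace X] {I : Type u} {q : X → I}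

theorem isClopen_preimage_of_isOpen_fibre (hq : ∀ i, IsOpen (q ⁻¹' {i})) (J : Set I) :
    IsClopen (q ⁻¹' J) := by
  have h : ∀ J : Set I, IsOpen (q ⁻¹' J) := fun J => by
    rw [← biUnion_preimage_singleton]
    exact isOpen_biUnion fun i _ => hq i
  refine ⟨?_, h J⟩
  rw [← isOpen_compl_iff, ← preimage_compl]
  exact h _

theorem IsCardLindelof.mk_image_le (hq : ∀ i, IsOpen (q ⁻¹' {i})) {κ : Cardinal.{u}} {s : Set X}
    (hs : IsCardLindelof κ s) : Cardinal.mk (q '' s) ≤ κ := by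
  -- In the cover by the disjoint fibres, no fibre that meets `s` can be omitted.
  obtain ⟨𝒱, h𝒱, hκ, hcov⟩ := hs (range fun i => q ⁻¹' {i}) (by rintro _ ⟨i, rfl⟩; exact hq i)
    fun x _ => mem_sUnion.2 ⟨_, ⟨q x, rfl⟩, rfl⟩
  have hmem : ∀ i : q '' s, q ⁻¹' {i.1} ∈ 𝒱 := by
    rintro ⟨_, x, hx, rfl⟩
    obtain ⟨W, hW, hxW⟩ := hcov hx
    obtain ⟨j, rfl⟩ := h𝒱 hW
    have hj : q x = j := hxW
    subst hj
    exact hW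
  refine (Cardinal.mk_le_of_injective (f := fun i : q '' s => (⟨_, hmem i⟩ : 𝒱)) ?_).trans hκ
  rintro ⟨_, x, hx, rfl⟩ ⟨j, hj⟩ h
  have h' : q ⁻¹' {q x} = q ⁻¹' {j} := congrArg Subtype.val h
  have hxj : x ∈ q ⁻¹' {j} := h' ▸ rfl
  exact Subtype.ext hxj

theorem isCardLindelof_of_mk_image_le (hqL : ∀ i, IsLindelof (q ⁻¹' {i})) {κ : Cardinal.{u}}
    (hκ : ℵ₀ ≤ κ) {s : Set X} (hs : IsClosed s) (h : Cardinal.mk (q '' s) ≤ κ) :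
    IsCardLindelof κ s := by
  intro 𝒰 h𝒰 hcov
  have hL : ∀ i : I, ∃ 𝒱 : Set (Set X), 𝒱 ⊆ 𝒰 ∧ 𝒱.Countable ∧ q ⁻¹' {i} ∩ s ⊆ ⋃₀ 𝒱 := by
    intro i
    obtain ⟨𝒱, h1, h2, h3⟩ := ((hqL i).inter_right hs).elim_countable_subcover_image
      (b := 𝒰) (c := id) h𝒰 (by
        simpa only [id, ← sUnion_eq_biUnion] using inter_subset_right.trans hcov)
    exact ⟨𝒱, h1, h2, by rwa [sUnion_eq_biUnion]⟩
  choose 𝒱 h1 h2 h3 using hL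
  -- A countable subcover for each of at most `κ` fibres costs at most `κ * ℵ₀ ≤ κ * κ = κ`.
  refine ⟨⋃ i ∈ q '' s, 𝒱 i, iUnion₂_subset fun i _ => h1 i, ?_, fun x hx => ?_⟩
  · refine (Cardinal.mk_biUnion_le 𝒱 (q '' s)).trans ?_
    refine (mul_le_mul' h (ciSup_le' fun i => ?_)).trans (Cardinal.mul_eq_self hκ).le
    exact (Cardinal.le_aleph0_iff_set_countable.2 (h2 _)).trans hκ
  · obtain ⟨W, hW, hxW⟩ := h3 (q x) ⟨rfl, hx⟩
    exact ⟨W, mem_iUnion₂.2 ⟨q x, mem_image_of_mem q hx, hW⟩, hxW⟩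

/-- The union of the fibres meeting `s` is already closed. Hence a support and its closure can be
counted interchangeably. -/
theorem image_closure_of_isOpen_fibre (hq : ∀ i, IsOpen (q ⁻¹' {i})) (s : Set X) :
    q '' closure s = q '' s := by
  refine (image_subset_iff.2 ?_).antisymm (image_mono subset_closure)
  exact closure_minimal (subset_preimage_image q s)
    (isClopen_preimage_of_isOpen_fibre hq _).isClosed

theorem lindelofNumber_eq_mk_of_fibres (hs : Function.Surjective q)
    (hq : ∀ i, IsOpen (q ⁻¹' {i})) (hqL : ∀ i, IsLindelof (q ⁻¹' {i}))
    (hI : ℵ₀ ≤ Cardinal.mk I) : lindelofNumber X = Cardinal.mk I := by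
  have himage : Cardinal.mk (q '' univ) = Cardinal.mk I := by
    rw [image_univ, hs.range_eq, Cardinal.mk_univ]
  have hle : ∀ κ, IsCardLindelof κ (univ : Set X) → Cardinal.mk I ≤ κ := fun κ h =>
    himage ▸ h.mk_image_le hq
  have hmem : IsCardLindelof (Cardinal.mk I) (univ : Set X) :=
    isCardLindelof_of_mk_image_le hqL hI isClosed_univ himage.le
  have : sInf {κ : Cardinal.{u} | IsCardLindelof κ (univ : Set X)} = Cardinal.mk I :=
    le_antisymm (csInf_le' hmem) (le_csInf ⟨_, hmem⟩ hle)
  rw [lindelofNumber, this, Cardinal.add_eq_left hI hI]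

theorem lindelofSpace_of_countable_fibres [Countable I] (hqL : ∀ i, IsLindelof (q ⁻¹' {i})) :
    LindelofSpace X := by
  rw [← isLindelof_univ_iff]
  have : (univ : Set X) = ⋃ i, q ⁻¹' {i} := by
    rw [← preimage_iUnion, iUnion_of_singleton, preimage_univ]
  rw [this]
  exact isLindelof_iUnion hqL

end Fibres

/-! ### The ideals of functions supported on few fibres. -/

section Algebra

variable {X : Type u} [TopologicalSpace X] (𝕜 : Type v) [RCLike 𝕜] {I : Type u} (q : X → I)

/-- The bounded continuous functions whose support meets at most `κ` fibres of `q`. -/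
def fibreSupported (κ : Cardinal.{u}) (hκ : ℵ₀ ≤ κ) : NonUnitalSubalgebra 𝕜 (X →ᵇ 𝕜) where
  carrier := {f | Cardinal.mk (q '' Function.support f) ≤ κ}
  zero_mem' := by
    have : Function.support (⇑(0 : X →ᵇ 𝕜)) = ∅ := by ext; simp
    rw [mem_ofPred_eq, this, image_empty]
    simp
  add_mem' := by
    intro f g hf hg
    refine (Cardinal.mk_le_mk_of_subset (t := q '' Function.support f ∪ q '' Function.support g)
      ?_).trans ((Cardinal.mk_union_le _ _).trans
        ((add_le_add hf hg).trans (Cardinal.add_eq_self hκ).le))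
    rw [← image_union]
    exact image_mono (Function.support_add f g)
  mul_mem' := by
    intro f g hf _
    refine (Cardinal.mk_le_mk_of_subset (image_mono fun x hx => ?_)).trans hf
    exact left_ne_zero_of_mul hx
  smul_mem' := by
    intro c f hf
    refine (Cardinal.mk_le_mk_of_subset (image_mono fun x hx => ?_)).trans hf
    exact right_ne_zero_of_mul (a := c) hx

variable {𝕜 q}

theorem mem_fibreSupported {κ : Cardinal.{u}} {hκ : ℵ₀ ≤ κ} {f : X →ᵇ 𝕜} :
    f ∈ fibreSupported 𝕜 q κ hκ ↔ Cardinal.mk (q '' Function.support f) ≤ κ := Iff.rfl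

theorem mem_fibreSupported_iff_exists {κ : Cardinal.{u}} {hκ : ℵ₀ ≤ κ} {f : X →ᵇ 𝕜} :
    f ∈ fibreSupported 𝕜 q κ hκ ↔
      ∃ J : Set I, Cardinal.mk J ≤ κ ∧ ∀ x, f x ≠ 0 → q x ∈ J := by
  refine ⟨fun h => ⟨_, h, fun x hx => mem_image_of_mem q hx⟩, fun ⟨J, hJ, h⟩ => ?_⟩
  exact (Cardinal.mk_le_mk_of_subset (image_subset_iff.2 fun x hx => h x hx)).trans hJ

theorem mem_fibreSupported_iff_isCardLindelof (hq : ∀ i, IsOpen (q ⁻¹' {i}))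
    (hqL : ∀ i, IsLindelof (q ⁻¹' {i})) {κ : Cardinal.{u}} {hκ : ℵ₀ ≤ κ} {f : X →ᵇ 𝕜} :
    f ∈ fibreSupported 𝕜 q κ hκ ↔ IsCardLindelof κ (tsupport f) := by
  have h : q '' tsupport f = q '' Function.support f := image_closure_of_isOpen_fibre hq _
  rw [mem_fibreSupported, ← h]
  exact ⟨isCardLindelof_of_mk_image_le hqL hκ (isClosed_tsupport f), fun h => h.mk_image_le hq⟩

theorem Cardinal.mk_iUnion_nat_le {κ : Cardinal.{u}} (hκ : ℵ₀ ≤ κ) {J : ℕ → Set I}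
    (hJ : ∀ n, Cardinal.mk (J n) ≤ κ) : Cardinal.mk (⋃ n, J n) ≤ κ := by
  have h := Cardinal.mk_iUnion_le_lift J
  simp only [Cardinal.mk_nat, Cardinal.lift_id', Cardinal.lift_aleph0] at h
  refine h.trans ((mul_le_mul' hκ (ciSup_le' hJ)).trans (Cardinal.mul_eq_self hκ).le)

theorem isClosed_fibreSupported (κ : Cardinal.{u}) (hκ : ℵ₀ ≤ κ) :
    IsClosed (fibreSupported 𝕜 q κ hκ : Set (X →ᵇ 𝕜)) := by
  refine IsSeqClosed.isClosed fun F f hF hf => ?_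
  -- Where every `F n` vanishes, so does the limit; the countably many index sets together still
  -- have size at most `κ`.
  refine mem_fibreSupported_iff_exists.2 ⟨⋃ n, q '' Function.support (F n),
    Cardinal.mk_iUnion_nat_le hκ hF, fun x hx => ?_⟩
  by_contra hn
  have h0 : ∀ n, F n x = 0 := fun n => by
    by_contra h
    exact hn (mem_iUnion.2 ⟨n, mem_image_of_mem q h⟩)
  have hlim : Filter.Tendsto (fun n => F n x) Filter.atTop (𝓝 (f x)) :=
    ((continuous_eval_const x).tendsto f).comp hf
  simp only [h0] at hlim
  exact hx (tendsto_nhds_unique hlim tendsto_const_nhds)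

/-- The functions supported on at most `κ` fibres form an ideal. -/
def fibreSupportedIdeal (𝕜 : Type v) [RCLike 𝕜] (q : X → I) (κ : Cardinal.{u}) (hκ : ℵ₀ ≤ κ) :
    Ideal (X →ᵇ 𝕜) where
  carrier := fibreSupported 𝕜 q κ hκ
  zero_mem' := zero_mem (fibreSupported 𝕜 q κ hκ)
  add_mem' := fun ha hb => add_mem (S := NonUnitalSubalgebra 𝕜 (X →ᵇ 𝕜)) ha hb
  smul_mem' := by
    intro c f hf
    refine (Cardinal.mk_le_mk_of_subset (image_mono fun x hx => ?_)).trans hf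
    exact right_ne_zero_of_mul (a := c x) hx

/-- The indicator function of a clopen set. -/
noncomputable def IsClopen.indicatorBCF (𝕜 : Type v) [RCLike 𝕜] {A : Set X} (hA : IsClopen A) :
    X →ᵇ 𝕜 :=
  BoundedContinuousFunction.ofNormedAddCommGroup (A.indicator fun _ => (1 : 𝕜))
    (continuous_const.indicator fun x hx => by simp [hA.frontier_eq] at hx) 1 fun x => by
      by_cases hx : x ∈ A <;> simp [hx]

theorem IsClopen.indicatorBCF_apply {A : Set X} (hA : IsClopen A) (x : X) :
    hA.indicatorBCF 𝕜 x = A.indicator (fun _ => (1 : 𝕜)) x := rfl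

theorem IsClopen.support_indicatorBCF {A : Set X} (hA : IsClopen A) :
    Function.support (hA.indicatorBCF 𝕜) = A := by
  ext x
  simp [IsClopen.indicatorBCF_apply]

theorem indicatorBCF_mem_fibreSupported (hs : Function.Surjective q)
    (hq : ∀ i, IsOpen (q ⁻¹' {i})) {κ : Cardinal.{u}} {hκ : ℵ₀ ≤ κ} {J : Set I} :
    (isClopen_preimage_of_isOpen_fibre hq J).indicatorBCF 𝕜 ∈ fibreSupported 𝕜 q κ hκ ↔
      Cardinal.mk J ≤ κ := by
  rw [mem_fibreSupported, IsClopen.support_indicatorBCF, image_preimage_eq J hs]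

theorem fibreSupported_lt (hs : Function.Surjective q) (hq : ∀ i, IsOpen (q ⁻¹' {i}))
    {κ₁ κ₂ : Cardinal.{u}} (h₁ : ℵ₀ ≤ κ₁) (h₂ : ℵ₀ ≤ κ₂) (h : κ₁ < κ₂) (hI : κ₂ ≤ Cardinal.mk I) :
    fibreSupported 𝕜 q κ₁ h₁ < fibreSupported 𝕜 q κ₂ h₂ := by
  refine lt_of_le_of_ne (fun f hf => mem_fibreSupported.2 (le_trans hf h.le)) fun heq => ?_
  -- The indicator of exactly `κ₂` fibres separates the two algebras.
  obtain ⟨J, hJ⟩ := Cardinal.le_mk_iff_exists_set.1 hI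
  have hmem := (indicatorBCF_mem_fibreSupported (𝕜 := 𝕜) hs hq (hκ := h₂)).2 hJ.le
  rw [← heq, indicatorBCF_mem_fibreSupported hs hq, hJ] at hmem
  exact hmem.not_gt h

theorem IsCompact.finite_image_of_isOpen_fibre (hq : ∀ i, IsOpen (q ⁻¹' {i})) {K : Set X}
    (hK : IsCompact K) : (q '' K).Finite := by
  obtain ⟨t, ht⟩ := hK.elim_finite_subcover (fun i => q ⁻¹' {i}) hq
    fun x _ => mem_iUnion.2 ⟨q x, rfl⟩
  refine t.finite_toSet.subset (image_subset_iff.2 fun x hx => ?_)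
  obtain ⟨i, hi, hxi⟩ := mem_iUnion₂.1 (ht hx)
  have : q x = i := hxi
  rw [mem_preimage, this]
  exact hi

theorem exists_inv_nat_le_norm {a : 𝕜} (ha : a ≠ 0) : ∃ n : ℕ, 1 / ((n : ℝ) + 1) ≤ ‖a‖ :=
  (exists_nat_one_div_lt (norm_pos_iff.2 ha)).imp fun _ h => h.le

theorem boundedVanishing_lt_fibreSupported (hs : Function.Surjective q)
    (hq : ∀ i, IsOpen (q ⁻¹' {i})) (hI : ℵ₀ ≤ Cardinal.mk I) :
    boundedVanishing X 𝕜 < fibreSupported 𝕜 q ℵ₀ le_rfl := by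
  refine lt_of_le_of_ne (fun f hf => ?_) fun heq => ?_
  · refine mem_fibreSupported_iff_exists.2
      ⟨⋃ n : ℕ, q '' {x | 1 / ((n : ℝ) + 1) ≤ ‖f x‖}, ?_, fun x hx => ?_⟩
    · rw [Cardinal.le_aleph0_iff_set_countable]
      exact countable_iUnion fun n =>
        ((hf _ (by positivity)).finite_image_of_isOpen_fibre hq).countable
    · obtain ⟨n, hn⟩ := exists_inv_nat_le_norm hx
      exact mem_iUnion.2 ⟨n, mem_image_of_mem q hn⟩
  -- The indicator of `ℵ₀` fibres is not in `C₀`: its level set at `1` meets infinitely many fibres,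
  -- whereas a compact set meets finitely many.
  · obtain ⟨J, hJ⟩ := Cardinal.le_mk_iff_exists_set.1 hI
    have hmem := (indicatorBCF_mem_fibreSupported (𝕜 := 𝕜) hs hq (hκ := le_rfl)).2 hJ.le
    rw [← heq] at hmem
    have hfin := (hmem 1 one_pos).finite_image_of_isOpen_fibre hq
    have hsub : J ⊆ q '' {x | 1 ≤
        ‖(isClopen_preimage_of_isOpen_fibre hq J).indicatorBCF 𝕜 x‖} := by
      intro j hj
      obtain ⟨x, rfl⟩ := hs j
      refine mem_image_of_mem q ?_
      have hx : x ∈ q ⁻¹' J := hj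
      rw [mem_ofPred_eq, IsClopen.indicatorBCF_apply, indicator_of_mem hx, norm_one]
    exact (Cardinal.lt_aleph0_iff_set_finite.2 (hfin.subset hsub)).ne hJ

theorem fibreSupported_eq_top {κ : Cardinal.{u}} {hκ : ℵ₀ ≤ κ} (h : Cardinal.mk I ≤ κ) :
    fibreSupported 𝕜 q κ hκ = ⊤ :=
  eq_top_iff.2 fun _ _ => (Cardinal.mk_set_le _).trans h

end Algebra

/-! ### Realising the ideals as `C₀(Y)` inside the Stone–Čech compactification. -/

section StoneCech

variable {X : Type u} [TopologicalSpace X]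

theorem IsClopen.exists_isClopen_stoneCech {A : Set X} (hA : IsClopen A) :
    ∃ B : Set (StoneCech X), IsClopen B ∧ stoneCechUnit ⁻¹' B = A := by
  classical
  -- `Bool` is compact Hausdorff, so the characteristic map of `A` extends.
  have hc : Continuous fun x => decide (x ∈ A) := by
    rw [continuous_bool_rng true]
    convert hA
    ext x
    simp
  refine ⟨stoneCechExtend hc ⁻¹' {true},
    (isClopen_discrete _).preimage (continuous_stoneCechExtend hc), ?_⟩
  ext x
  simp [stoneCechExtend_stoneCechUnit hc]

theorem IsOpen.subset_of_stoneCechUnit_preimage_subset {U B : Set (StoneCech X)} (hU : IsOpen U)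
    (hB : IsClosed B) (h : stoneCechUnit ⁻¹' U ⊆ stoneCechUnit ⁻¹' B) : U ⊆ B := by
  by_contra hn
  obtain ⟨p, hpU, hpB⟩ := not_subset.1 hn
  obtain ⟨x, hxU, hxB⟩ := denseRange_stoneCechUnit.exists_mem_open
    (hU.inter hB.isOpen_compl) ⟨p, hpU, hpB⟩
  exact hxB (h hxU)

theorem BoundedContinuousFunction.exists_stoneCech_extension {𝕜 : Type v} [RCLike 𝕜]
    (f : X →ᵇ 𝕜) : ∃ F : StoneCech X →ᵇ 𝕜, ∀ x, F (stoneCechUnit x) = f x := by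
  have : CompactSpace (Metric.closedBall (0 : 𝕜) ‖f‖) :=
    isCompact_iff_compactSpace.1 (isCompact_closedBall _ _)
  have hc : Continuous fun x => (⟨f x, by simpa using f.norm_coe_le_norm x⟩ :
      Metric.closedBall (0 : 𝕜) ‖f‖) := f.continuous.subtype_mk _
  refine ⟨BoundedContinuousFunction.mkOfCompact
    ⟨Subtype.val ∘ stoneCechExtend hc,
      continuous_subtype_val.comp (continuous_stoneCechExtend hc)⟩, fun x => ?_⟩
  simp [stoneCechExtend_stoneCechUnit hc]

variable (𝕜 : Type v) [RCLike 𝕜]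

theorem boundedCompactSupport_le_boundedVanishing :
    boundedCompactSupport X 𝕜 ≤ boundedVanishing X 𝕜 := by
  intro f hf ε hε
  refine IsCompact.of_isClosed_subset hf (isClosed_le continuous_const f.continuous.norm) ?_
  intro x hx
  exact subset_tsupport f (norm_pos_iff.1 (hε.trans_le hx))

/-- Pullback of bounded continuous functions along a continuous map, from `C₀` into a subalgebra. -/
def pullbackBoundedVanishing {Y : Type*} [TopologicalSpace Y] (e : C(X, Y))
    (H : NonUnitalSubalgebra 𝕜 (X →ᵇ 𝕜))
    (h : ∀ g ∈ boundedVanishing Y 𝕜, g.compContinuous e ∈ H) :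
    boundedVanishing Y 𝕜 →ₙₐ[𝕜] H where
  toFun g := ⟨g.1.compContinuous e, h g.1 g.2⟩
  map_smul' _ _ := rfl
  map_zero' := rfl
  map_add' _ _ := rfl
  map_mul' _ _ := rfl

variable {𝕜}

theorem DenseRange.isometry_compContinuous {Y : Type*} [TopologicalSpace Y] {e : C(X, Y)}
    (he : DenseRange e) : Isometry fun g : Y →ᵇ 𝕜 => g.compContinuous e := by
  refine Isometry.of_dist_eq fun f g => le_antisymm ?_ ?_
  · exact (BoundedContinuousFunction.dist_le dist_nonneg).2
      fun x => BoundedContinuousFunction.dist_coe_le_dist (e x)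
  · refine (BoundedContinuousFunction.dist_le dist_nonneg).2 fun y => ?_
    refine he.induction_on y (isClosed_le (f.continuous.dist g.continuous) continuous_const)
      fun x => ?_
    exact BoundedContinuousFunction.dist_coe_le_dist (f := f.compContinuous e)
      (g := g.compContinuous e) x

variable {I : Type u} {q : X → I}

/-- The functions supported on at most `κ` fibres are the `C₀`-functions on the union, in the
Stone–Čech compactification, of the closures of unions of at most `κ` fibres. -/
theorem exists_isometry_fibreSupported (𝕜 : Type v) [RCLike 𝕜] (hq : ∀ i, IsOpen (q ⁻¹' {i}))
    (κ : Cardinal.{u}) (hκ : ℵ₀ ≤ κ) :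
    ∃ (Y : Type u) (_ : TopologicalSpace Y), T2Space Y ∧ LocallyCompactSpace Y ∧
      boundedVanishing Y 𝕜 = boundedCompactSupport Y 𝕜 ∧
      ∃ φ : fibreSupported 𝕜 q κ hκ →ₙₐ[𝕜] boundedVanishing Y 𝕜,
        Isometry φ ∧ Function.Surjective φ := by
  choose B hB hBq using fun J : Set I =>
    (isClopen_preimage_of_isOpen_fibre hq J).exists_isClopen_stoneCech
  have hmemB : ∀ J x, stoneCechUnit x ∈ B J ↔ q x ∈ J := fun J x => by
    rw [← mem_preimage, hBq, mem_preimage]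
  have hmono : ∀ J K, J ⊆ K → B J ⊆ B K := fun J K hJK =>
    (hB J).isOpen.subset_of_stoneCechUnit_preimage_subset (hB K).isClosed (by
      rw [hBq, hBq]
      exact preimage_mono hJK)
  let S : Set (StoneCech X) := ⋃ J ∈ {J : Set I | Cardinal.mk J ≤ κ}, B J
  have hSB : ∀ J : Set I, Cardinal.mk J ≤ κ → B J ⊆ S := fun J hJ =>
    subset_biUnion_of_mem (u := B) hJ
  have hSopen : IsOpen S := isOpen_biUnion fun J _ => (hB J).isOpen
  have hcompact : ∀ J : Set I, Cardinal.mk J ≤ κ → IsCompact ((↑) ⁻¹' B J : Set S) := fun J hJ =>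
    Topology.IsInducing.subtypeVal.isCompact_preimage'
      (hB J).isClosed.isCompact (by rw [Subtype.range_coe]; exact hSB J hJ)
  have hunit : ∀ x, stoneCechUnit x ∈ S := fun x =>
    hSB {q x} (by simpa only [Cardinal.mk_singleton] using Cardinal.one_le_aleph0.trans hκ) ((hmemB _ _).2 rfl)
  let e : C(X, S) := ⟨fun x => ⟨stoneCechUnit x, hunit x⟩,
    continuous_stoneCechUnit.subtype_mk _⟩
  have he : DenseRange e := by
    refine dense_iff_inter_open.2 ?_
    rintro _ ⟨U, hU, rfl⟩ ⟨p, hp⟩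
    obtain ⟨x, hxU, -⟩ := denseRange_stoneCechUnit.exists_mem_open (hU.inter hSopen)
      ⟨p.1, hp, p.2⟩
    exact ⟨e x, hxU, mem_range_self x⟩
  -- A `C₀`-function on `S` vanishes off the closure of a union of at most `κ` fibres.
  have hvanish : ∀ g ∈ boundedVanishing S 𝕜, ∃ J : Set I, Cardinal.mk J ≤ κ ∧
      Function.support g ⊆ (↑) ⁻¹' B J := by
    intro g hg
    have hn : ∀ n : ℕ, ∃ J : Set I, Cardinal.mk J ≤ κ ∧
        {y : S | 1 / ((n : ℝ) + 1) ≤ ‖g y‖} ⊆ (↑) ⁻¹' B J := by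
      intro n
      -- The sets `B J` are directed, as `κ + κ = κ`, so one of them contains the whole compact
      -- level set.
      obtain ⟨J, hJ⟩ := (hg (1 / ((n : ℝ) + 1)) (by positivity)).elim_directed_cover
        (ι := {J : Set I // Cardinal.mk J ≤ κ}) (hι := ⟨⟨∅, by simp⟩⟩)
        (fun J => (↑) ⁻¹' B J.1) (fun J => (hB J.1).isOpen.preimage continuous_subtype_val)
        (fun y _ => by
          obtain ⟨J, hJ, hyJ⟩ := mem_iUnion₂.1 y.2
          exact mem_iUnion.2 ⟨⟨J, hJ⟩, hyJ⟩)
        (fun J K => ⟨⟨J.1 ∪ K.1, (Cardinal.mk_union_le _ _).trans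
            ((add_le_add J.2 K.2).trans (Cardinal.add_eq_self hκ).le)⟩,
          preimage_mono (hmono _ _ subset_union_left),
          preimage_mono (hmono _ _ subset_union_right)⟩)
      exact ⟨J.1, J.2, hJ⟩
    choose J hJ hgJ using hn
    refine ⟨⋃ n, J n, Cardinal.mk_iUnion_nat_le hκ hJ, fun y hy => ?_⟩
    obtain ⟨n, hn⟩ := exists_inv_nat_le_norm hy
    exact hmono _ _ (subset_iUnion J n) (hgJ n hn)
  let ψ := pullbackBoundedVanishing 𝕜 e (fibreSupported 𝕜 q κ hκ) fun g hg => by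
    obtain ⟨J, hJ, hgJ⟩ := hvanish g hg
    exact mem_fibreSupported_iff_exists.2 ⟨J, hJ, fun x hx => (hmemB J x).1 (hgJ hx)⟩
  have hψ : Isometry ψ := fun f g => he.isometry_compContinuous f.1 g.1
  have hψs : Function.Surjective ψ := by
    rintro ⟨f, hf⟩
    obtain ⟨J, hJ, hfJ⟩ := mem_fibreSupported_iff_exists.1 hf
    obtain ⟨F, hF⟩ := f.exists_stoneCech_extension
    -- The support of `F` is open and the image of `X` is dense, so containment need only be checked
    -- on `X`.
    have hFJ : Function.support F ⊆ B J :=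
      F.continuous.isOpen_support.subset_of_stoneCechUnit_preimage_subset (hB J).isClosed
        fun x hx => (hmemB J x).2 (hfJ x (hF x ▸ hx))
    refine ⟨⟨F.compContinuous ⟨Subtype.val, continuous_subtype_val⟩, fun ε hε => ?_⟩,
      Subtype.ext (BoundedContinuousFunction.ext hF)⟩
    refine (hcompact J hJ).of_isClosed_subset (isClosed_le continuous_const
      (F.compContinuous ⟨Subtype.val, continuous_subtype_val⟩).continuous.norm) fun y hy => ?_
    exact hFJ (norm_pos_iff.1 (hε.trans_le hy))
  -- The pullback `ψ` goes from `C₀(S)` to the ideal; the required isomorphism is its inverse.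
  have hinv : Function.RightInverse (Function.surjInv hψs) ψ := Function.surjInv_eq hψs
  have hinv' : Function.LeftInverse (Function.surjInv hψs) ψ :=
    Function.leftInverse_surjInv ⟨hψ.injective, hψs⟩
  refine ⟨S, inferInstance, inferInstance, hSopen.locallyCompactSpace, le_antisymm (fun g hg => ?_)
    (boundedCompactSupport_le_boundedVanishing 𝕜), NonUnitalAlgHom.inverse ψ _ hinv' hinv,
    hψ.right_inv hinv, hinv'.surjective⟩
  obtain ⟨J, hJ, hgJ⟩ := hvanish g hg
  exact (hcompact J hJ).of_isClosed_subset (isClosed_tsupport g)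
    (closure_minimal hgJ ((hB J).isClosed.preimage continuous_subtype_val))

end StoneCech

theorem theorem4p11 (𝕜 : Type v) [RCLike 𝕜] (X : Type u) [TopologicalSpace X]
    (hX : (T2Space X ∧ LocallyCompactSpace X ∧ ParacompactSpace X) ∨
      (TopologicalSpace.MetrizableSpace X ∧ IsLocallyLindelof X))
    (hL : ¬ LindelofSpace X) :
    ∃ (l : Ordinal.{u}) (H : Ordinal.{u} → NonUnitalSubalgebra 𝕜 (X →ᵇ 𝕜)),
      ℵ_ l = lindelofNumber X ∧
      -- the chain
      boundedVanishing X 𝕜 < H 0 ∧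
      (∀ μ κ : Ordinal.{u}, μ < κ → κ ≤ l → H μ < H κ) ∧
      H l = ⊤ ∧
      ∀ μ : Ordinal.{u}, μ ≤ l →
        -- `H μ` consists of the functions with `ℵ_μ`-Lindelöf support
        (∀ f : X →ᵇ 𝕜, f ∈ H μ ↔ IsCardLindelof (ℵ_ μ) (tsupport f)) ∧
        -- `H μ` is a closed ideal of `C_b(X)`
        IsClosed (H μ : Set (X →ᵇ 𝕜)) ∧
        (∃ I : Ideal (X →ᵇ 𝕜), (I : Set (X →ᵇ 𝕜)) = (H μ : Set (X →ᵇ 𝕜))) ∧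
        -- `H μ` is isometrically isomorphic to `C₀(Y) = C_c(Y)`
        ∃ (Y : Type u) (_ : TopologicalSpace Y),
          T2Space Y ∧ LocallyCompactSpace Y ∧
          boundedVanishing Y 𝕜 = boundedCompactSupport Y 𝕜 ∧
          ∃ φ : H μ →ₙₐ[𝕜] boundedVanishing Y 𝕜, Isometry φ ∧ Function.Surjective φ := by
  -- The two alternatives are used only through paracompactness and local Lindelöfness.
  have hpara : ParacompactSpace X := by
    rcases hX with ⟨-, -, h⟩ | ⟨h, -⟩
    · exact h
    · let _ := TopologicalSpace.metrizableSpaceMetric X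
      infer_instance
  have hloc : IsLocallyLindelof X := by
    rcases hX with ⟨-, h, -⟩ | ⟨-, h⟩
    · intro x
      obtain ⟨K, hK, hx⟩ := exists_compact_mem_nhds x
      exact ⟨K, hx, hK.isLindelof⟩
    · exact h
  obtain ⟨I, q, hs, hq, hqL⟩ := hloc.exists_lindelof_fibres
  have hI : ℵ₀ ≤ Cardinal.mk I := by
    by_contra h
    have : Countable I := Cardinal.mk_le_aleph0_iff.1 (not_le.1 h).le
    exact hL (lindelofSpace_of_countable_fibres hqL)
  obtain ⟨l, hl⟩ := Cardinal.mem_range_aleph_iff.2 hI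
  refine ⟨l, fun μ => fibreSupported 𝕜 q (ℵ_ μ) (Cardinal.aleph0_le_aleph μ),
    hl.trans (lindelofNumber_eq_mk_of_fibres hs hq hqL hI).symm, ?_, ?_,
    fibreSupported_eq_top hl.ge, fun μ _ => ⟨fun f => ?_, ?_, ?_, ?_⟩⟩
  · simpa only [Cardinal.aleph_zero] using boundedVanishing_lt_fibreSupported hs hq hI
  · intro μ κ hμκ hκ
    exact fibreSupported_lt hs hq _ _ (Cardinal.aleph_lt_aleph.2 hμκ)
      (hl ▸ Cardinal.aleph_le_aleph.2 hκ)
  · exact mem_fibreSupported_iff_isCardLindelof hq hqL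
  · exact isClosed_fibreSupported _ _
  · exact ⟨fibreSupportedIdeal 𝕜 q _ (Cardinal.aleph0_le_aleph μ), rfl⟩
  · exact exists_isometry_fibreSupported 𝕜 hq _ _
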